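/- Fix a complex number $q$ of modulus one which is not a root of unity, a square root $q^{1/2}$ of $q$, and a real number $\mu\neq 0$. Let ${\cal A}=SL_q(2,\mathbf R)$ be the $*$-Hopf algebra over $\mathbf C$ generated by four real elements $a,b,c,d$ (i.e. $a^*=a$, $b^*=b$, $c^*=c$, $d^*=d$) with relations $$ab=q\,ba,\quad ac=q\,ca,\quad bc=cb,\quad bd=q\,db,\quad cd=q\,dc,\quad da-q^{-1}bc=1=ad-q\,bc,$$ and with $$\Delta\begin{pmatrix}a&b\\c&d\end{pmatrix}=\begin{pmatrix}a&b\\c&d\end{pmatrix}\otimes\begin{pmatrix}a&b\\c&d\end{pmatrix},\quad \varepsilon\begin{pmatrix}a&b\\c&d\end{pmatrix}=\begin{pmatrix}1&0\\0&1\end{pmatrix},\quad S\begin{pmatrix}a&b\\c&d\end{pmatrix}=\begin{pmatrix}d&-q^{-1}b\\-q\,c&a\end{pmatrix}.$$ Put $\tau=*\circ S$. The linear span ${\cal C}$ of $a-d+2q^{1/2}\mu\,b$ and $q\mu^2\,b+c$ is a $\tau$-invariant two-sided coideal of ${\cal A}$; let ${\bf R}_q={\cal A}/({\cal C}{\cal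 A})$ be the quotient by the right ideal generated by ${\cal C}$, with quotient map $r$. It carries the induced coalgebra structure, the induced right ${\cal A}$-action $r(x)\cdot y=r(xy)$ and the induced antilinear map $\tau$, $\tau(r(x))=r(\tau(x))$. For $n\in{\bf N}=\{0,1,2,\dots\}$ let $$v_n=r\big((a+q^{1/2}\mu\,b)(a+q^{3/2}\mu\,b)\cdots(a+q^{n-1/2}\mu\,b)\big),\qquad v_0=r(1),$$ where $q^{k/2}:=(q^{1/2})^k$, and for $n\ge 1$ let $$X_n=\sum_{i=1}^n\frac{(q-q^{-1})^{i-1}\,q^{i/2}\,\mu^i\,[n-1]_q!}{[i]_q\,[n-i]_q!}\;v_{n-i}\cdot b^i,$$ where $[k]_q=(q^k-q^{-k})/(q-q^{-1})$ and $[k]_q!=[1]_q[2]_q\cdots[k]_q$, $[0]_q!=1$. Then every $v_n$ ($n\in{\bf N}$) is group-like, i.e. $\Delta v_n=v_n\otimes v_n$ and $\varepsilon(v_n)=1$; for every $n\geq 1$ $$\Delta X_n=X_n\otimes v_n+v_n\otimes X_n,\qquad \tau(X_n)=-X_n;$$ and the elements $v_n$ ($n\in{\bf N}$) together with the $X_n$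 ($n\geq 1$) form a linear basis of ${\bf R}_q$. -/

import Mathlib

open scoped TensorProduct

set_option linter.unusedSimpArgs false
set_option linter.unusedTactic false
set_option linter.unnecessarySeqFocus false
set_option linter.unreachableTactic false

noncomputable section

/-- The names of the four generators. -/
inductive SLqGen : Type
  | a | b | c | d

/-- The defining relations of the function algebra on the quantum group `SL_q(2, ℝ)`. -/
inductive SLqRel (q : ℂ) : FreeAlgebra ℂ SLqGen → FreeAlgebra ℂ SLqGen → Prop
  | ab : SLqRel q (FreeAlgebra.ι ℂ .a * FreeAlgebra.ι ℂ .b)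
      (q • (FreeAlgebra.ι ℂ .b * FreeAlgebra.ι ℂ .a))
  | ac : SLqRel q (FreeAlgebra.ι ℂ .a * FreeAlgebra.ι ℂ .c)
      (q • (FreeAlgebra.ι ℂ .c * FreeAlgebra.ι ℂ .a))
  | bc : SLqRel q (FreeAlgebra.ι ℂ .b * FreeAlgebra.ι ℂ .c)
      (FreeAlgebra.ι ℂ .c * FreeAlgebra.ι ℂ .b)
  | bd : SLqRel q (FreeAlgebra.ι ℂ .b * FreeAlgebra.ι ℂ .d)
      (q • (FreeAlgebra.ι ℂ .d * FreeAlgebra.ι ℂ .b))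
  | cd : SLqRel q (FreeAlgebra.ι ℂ .c * FreeAlgebra.ι ℂ .d)
      (q • (FreeAlgebra.ι ℂ .d * FreeAlgebra.ι ℂ .c))
  | da : SLqRel q (FreeAlgebra.ι ℂ .d * FreeAlgebra.ι ℂ .a
      - q⁻¹ • (FreeAlgebra.ι ℂ .b * FreeAlgebra.ι ℂ .c)) 1
  | ad : SLqRel q (FreeAlgebra.ι ℂ .a * FreeAlgebra.ι ℂ .d
      - q • (FreeAlgebra.ι ℂ .b * FreeAlgebra.ι ℂ .c)) 1

/-- The function algebra on the quantum group `SL_q(2, ℝ)`, for `q` of modulus one. -/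
def SLq (q : Circle) : Type := RingQuot (SLqRel (q : ℂ))

namespace SLq

instance (q : Circle) : Ring (SLq q) := inferInstanceAs (Ring (RingQuot _))
instance (q : Circle) : Algebra ℂ (SLq q) := inferInstanceAs (Algebra ℂ (RingQuot _))

/-- The quotient map from the free algebra. -/
def mk (q : Circle) : FreeAlgebra ℂ SLqGen →ₐ[ℂ] SLq q :=
  RingQuot.mkAlgHom ℂ (SLqRel (q : ℂ))

/-- The generator `a`. -/
def a (q : Circle) : SLq q := mk q (FreeAlgebra.ι ℂ .a)
/-- The generator `b`. -/
def b (q : Circle) : SLq q := mk q (FreeAlgebra.ι ℂ .b)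
/-- The generator `c`. -/
def c (q : Circle) : SLq q := mk q (FreeAlgebra.ι ℂ .c)
/-- The generator `d`. -/
def d (q : Circle) : SLq q := mk q (FreeAlgebra.ι ℂ .d)

variable (q : Circle)

theorem mk_rel {x y : FreeAlgebra ℂ SLqGen} (h : SLqRel (q : ℂ) x y) : mk q x = mk q y :=
  RingQuot.mkAlgHom_rel ℂ h

theorem a_mul_b : a q * b q = (q : ℂ) • (b q * a q) := by
  simpa [a, b] using mk_rel q SLqRel.ab
theorem a_mul_c : a q * c q = (q : ℂ) • (c q * a q) := by
  simpa [a, c] using mk_rel q SLqRel.ac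
theorem b_mul_c : b q * c q = c q * b q := by
  simpa [b, c] using mk_rel q SLqRel.bc
theorem b_mul_d : b q * d q = (q : ℂ) • (d q * b q) := by
  simpa [b, d] using mk_rel q SLqRel.bd
theorem c_mul_d : c q * d q = (q : ℂ) • (d q * c q) := by
  simpa [c, d] using mk_rel q SLqRel.cd
theorem d_mul_a' : d q * a q - (q : ℂ)⁻¹ • (b q * c q) = 1 := by
  simpa [a, b, c, d, -Circle.coe_inv, -map_inv₀] using mk_rel q SLqRel.da
theorem a_mul_d' : a q * d q - (q : ℂ) • (b q * c q) = 1 := by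
  simpa [a, b, c, d] using mk_rel q SLqRel.ad
theorem d_mul_a : d q * a q = 1 + (q : ℂ)⁻¹ • (b q * c q) :=
  sub_eq_iff_eq_add.1 (d_mul_a' q)
theorem a_mul_d : a q * d q = 1 + (q : ℂ) • (b q * c q) :=
  sub_eq_iff_eq_add.1 (a_mul_d' q)

theorem induction {P : SLq q → Prop} (hz : ∀ z : ℂ, P (algebraMap ℂ _ z))
    (ha : P (a q)) (hb : P (b q)) (hc : P (c q)) (hd : P (d q))
    (hadd : ∀ x y, P x → P y → P (x + y)) (hmul : ∀ x y, P x → P y → P (x * y))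
    (x : SLq q) : P x := by
  obtain ⟨y, rfl⟩ : ∃ y, mk q y = x := RingQuot.mkAlgHom_surjective ℂ _ x
  induction y using FreeAlgebra.induction with
  | grade0 z => simpa using hz z
  | grade1 g => cases g <;> assumption
  | mul x y hx hy => simpa using hmul _ _ hx hy
  | add x y hx hy => simpa using hadd _ _ hx hy

theorem b_mul_a : b q * a q = (q : ℂ)⁻¹ • (a q * b q) := by
  rw [a_mul_b, smul_smul, inv_mul_cancel₀ q.coe_ne_zero, one_smul]
theorem c_mul_a : c q * a q = (q : ℂ)⁻¹ • (a q * c q) := by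
  rw [a_mul_c, smul_smul, inv_mul_cancel₀ q.coe_ne_zero, one_smul]
theorem d_mul_b : d q * b q = (q : ℂ)⁻¹ • (b q * d q) := by
  rw [b_mul_d, smul_smul, inv_mul_cancel₀ q.coe_ne_zero, one_smul]
theorem d_mul_c : d q * c q = (q : ℂ)⁻¹ • (c q * d q) := by
  rw [c_mul_d, smul_smul, inv_mul_cancel₀ q.coe_ne_zero, one_smul]

/-- Four elements of an algebra satisfy the defining relations. -/
structure Rels {B : Type} [Ring B] [Algebra ℂ B] (a' b' c' d' : B) : Prop where
  ab : a' * b' = (q : ℂ) • (b' * a')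
  ac : a' * c' = (q : ℂ) • (c' * a')
  bc : b' * c' = c' * b'
  bd : b' * d' = (q : ℂ) • (d' * b')
  cd : c' * d' = (q : ℂ) • (d' * c')
  da : d' * a' - (q : ℂ)⁻¹ • (b' * c') = 1
  ad : a' * d' - (q : ℂ) • (b' * c') = 1

/-- The images of the generators under a homomorphism. -/
def genMap {B : Type} (a' b' c' d' : B) : SLqGen → B
  | .a => a'
  | .b => b'
  | .c => c'
  | .d => d'

/-- The universal property: four elements of an algebra which satisfy the relations define a
homomorphism. -/
def lift {B : Type} [Ring B] [Algebra ℂ B] (a' b' c' d' : B) (h : Rels q a' b' c' d') :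
    SLq q →ₐ[ℂ] B :=
  RingQuot.liftAlgHom ℂ ⟨FreeAlgebra.lift ℂ (genMap a' b' c' d'), by
    intro x y hxy
    obtain ⟨h1, h2, h3, h4, h5, h6, h7⟩ := h
    cases hxy <;> simpa [genMap, -Circle.coe_inv, -map_inv₀]⟩

section lift
variable {B : Type} [Ring B] [Algebra ℂ B] {a' b' c' d' : B} {h : Rels q a' b' c' d'}

theorem lift_mk (x : FreeAlgebra ℂ SLqGen) :
    lift q a' b' c' d' h (mk q x) = FreeAlgebra.lift ℂ (genMap a' b' c' d') x :=
  RingQuot.liftAlgHom_mkAlgHom_apply ℂ _ _ _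

@[simp] theorem lift_a : lift q a' b' c' d' h (a q) = a' := by
  rw [a, lift_mk]; simp [genMap]
@[simp] theorem lift_b : lift q a' b' c' d' h (b q) = b' := by
  rw [b, lift_mk]; simp [genMap]
@[simp] theorem lift_c : lift q a' b' c' d' h (c q) = c' := by
  rw [c, lift_mk]; simp [genMap]
@[simp] theorem lift_d : lift q a' b' c' d' h (d q) = d' := by
  rw [d, lift_mk]; simp [genMap]
end lift

theorem algHom_ext {B : Type} [Ring B] [Algebra ℂ B] {f g : SLq q →ₐ[ℂ] B}
    (ha : f (a q) = g (a q)) (hb : f (b q) = g (b q)) (hc : f (c q) = g (c q))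
    (hd : f (d q) = g (d q)) : f = g := by
  ext x
  induction x using induction q with
  | hz z => simp
  | ha => exact ha
  | hb => exact hb
  | hc => exact hc
  | hd => exact hd
  | hadd x y hx hy => simp [hx, hy]
  | hmul x y hx hy => simp [hx, hy]

theorem comul_rels : Rels q (a q ⊗ₜ[ℂ] a q + b q ⊗ₜ[ℂ] c q) (a q ⊗ₜ[ℂ] b q + b q ⊗ₜ[ℂ] d q)
    (c q ⊗ₜ[ℂ] a q + d q ⊗ₜ[ℂ] c q) (c q ⊗ₜ[ℂ] b q + d q ⊗ₜ[ℂ] d q) := by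
  have hq : (q : ℂ) ≠ 0 := q.coe_ne_zero
  constructor <;>
  · simp only [add_mul, mul_add, Algebra.TensorProduct.tmul_mul_tmul, b_mul_a, c_mul_a,
      ← b_mul_c, d_mul_b, d_mul_c, d_mul_a, a_mul_d, TensorProduct.add_tmul,
      TensorProduct.tmul_add, ← TensorProduct.smul_tmul', TensorProduct.tmul_smul, smul_smul,
      smul_add, Algebra.TensorProduct.one_def]
    match_scalars <;> field_simp <;> ring

/-- The coproduct: the matrix coproduct on the matrix of generators. -/
def comulHom : SLq q →ₐ[ℂ] SLq q ⊗[ℂ] SLq q :=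
  lift q (a q ⊗ₜ a q + b q ⊗ₜ c q) (a q ⊗ₜ b q + b q ⊗ₜ d q)
    (c q ⊗ₜ a q + d q ⊗ₜ c q) (c q ⊗ₜ b q + d q ⊗ₜ d q) (comul_rels q)

/-- The counit. -/
def counitHom : SLq q →ₐ[ℂ] ℂ :=
  lift q 1 0 0 1 (by constructor <;> simp)

instance : Bialgebra ℂ (SLq q) :=
  Bialgebra.ofAlgHom (comulHom q) (counitHom q)
    (by
      apply algHom_ext <;>
        simp [comulHom, TensorProduct.add_tmul, TensorProduct.tmul_add] <;> abel)
    (by apply algHom_ext <;> simp [comulHom, counitHom])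
    (by apply algHom_ext <;> simp [comulHom, counitHom])

theorem comul_def (x : SLq q) : Coalgebra.comul (R := ℂ) x = comulHom q x := rfl
theorem counit_def (x : SLq q) : Coalgebra.counit (R := ℂ) x = counitHom q x := rfl

theorem antipode_rels : Rels q (MulOpposite.op (d q)) (.op (-((q : ℂ)⁻¹ • b q)))
    (.op (-((q : ℂ) • c q))) (.op (a q)) := by
  have hq : (q : ℂ) ≠ 0 := q.coe_ne_zero
  constructor <;>
  · apply MulOpposite.unop_injective
    simp only [MulOpposite.unop_mul, MulOpposite.unop_sub, MulOpposite.unop_smul,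
      MulOpposite.unop_op, MulOpposite.unop_one, neg_mul, mul_neg, smul_mul_assoc,
      mul_smul_comm, b_mul_a, c_mul_a, ← b_mul_c, d_mul_b, d_mul_c, d_mul_a, a_mul_d, smul_smul]
    match_scalars <;> field_simp <;> ring

/-- The antipode, an antihomomorphism, as a homomorphism to the opposite algebra. -/
def antipodeHom : SLq q →ₐ[ℂ] (SLq q)ᵐᵒᵖ :=
  lift q (.op (d q)) (.op (-((q : ℂ)⁻¹ • b q))) (.op (-((q : ℂ) • c q))) (.op (a q))
    (antipode_rels q)

/-- The antipode as a linear map. -/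
def antipodeLin : SLq q →ₗ[ℂ] SLq q :=
  (MulOpposite.opLinearEquiv ℂ).symm.toLinearMap ∘ₗ (antipodeHom q).toLinearMap

theorem antipodeLin_apply (x : SLq q) : antipodeLin q x = (antipodeHom q x).unop := rfl

theorem antipodeLin_mul (x y : SLq q) :
    antipodeLin q (x * y) = antipodeLin q y * antipodeLin q x := by
  simp [antipodeLin_apply]

theorem antipode_left_mul (U V : SLq q ⊗[ℂ] SLq q) (z : ℂ)
    (hU : LinearMap.mul' ℂ _ ((antipodeLin q).rTensor _ U) = algebraMap ℂ _ z) :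
    LinearMap.mul' ℂ _ ((antipodeLin q).rTensor _ (U * V)) =
      z • LinearMap.mul' ℂ _ ((antipodeLin q).rTensor _ V) := by
  induction V with
  | zero => simp
  | add V W hV hW => simp [mul_add, hV, hW]
  | tmul v w =>
    have key : LinearMap.mul' ℂ _ ((antipodeLin q).rTensor _ (U * v ⊗ₜ w)) =
        antipodeLin q v * LinearMap.mul' ℂ _ ((antipodeLin q).rTensor _ U) * w := by
      clear hU
      induction U with
      | zero => simp
      | add U W hU hW => simp [add_mul, mul_add, hU, hW]
      | tmul x y => simp [antipodeLin_mul, mul_assoc]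
    rw [key, hU, ← Algebra.commutes, mul_assoc, Algebra.smul_def]
    simp

theorem antipode_right_mul (U V : SLq q ⊗[ℂ] SLq q) (z : ℂ)
    (hV : LinearMap.mul' ℂ _ ((antipodeLin q).lTensor _ V) = algebraMap ℂ _ z) :
    LinearMap.mul' ℂ _ ((antipodeLin q).lTensor _ (U * V)) =
      z • LinearMap.mul' ℂ _ ((antipodeLin q).lTensor _ U) := by
  induction U with
  | zero => simp
  | add U W hU hW => simp [add_mul, hU, hW]
  | tmul v w =>
    have key : LinearMap.mul' ℂ _ ((antipodeLin q).lTensor _ (v ⊗ₜ w * V)) =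
        v * LinearMap.mul' ℂ _ ((antipodeLin q).lTensor _ V) * antipodeLin q w := by
      clear hV
      induction V with
      | zero => simp
      | add U W hU hW => simp [add_mul, mul_add, hU, hW]
      | tmul x y => simp [antipodeLin_mul, mul_assoc]
    rw [key, hV, ← Algebra.commutes, mul_assoc, Algebra.smul_def]
    simp

instance : HopfAlgebra ℂ (SLq q) where
  antipode := antipodeLin q
  mul_antipode_rTensor_comul := by
    have hq : (q : ℂ) ≠ 0 := q.coe_ne_zero
    ext x
    simp only [LinearMap.comp_apply, comul_def, counit_def, Algebra.linearMap_apply]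
    induction x using induction q with
    | hz z => simp [Algebra.TensorProduct.algebraMap_apply, antipodeLin_apply]
    | hadd x y hx hy => simp [hx, hy]
    | hmul x y hx hy =>
      rw [map_mul, antipode_left_mul q _ _ _ hx, hy, map_mul, map_mul, Algebra.smul_def]
    | _ =>
      simp [comulHom, counitHom, antipodeLin_apply, antipodeHom, -Circle.coe_inv, -map_inv₀]
      simp only [b_mul_a, c_mul_a, ← b_mul_c, d_mul_b, d_mul_c, d_mul_a, a_mul_d, smul_smul]
      match_scalars <;> field_simp <;> ring
  mul_antipode_lTensor_comul := by
    have hq : (q : ℂ) ≠ 0 := q.coe_ne_zero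
    ext x
    simp only [LinearMap.comp_apply, comul_def, counit_def, Algebra.linearMap_apply]
    induction x using induction q with
    | hz z => simp [Algebra.TensorProduct.algebraMap_apply, antipodeLin_apply]
    | hadd x y hx hy => simp [hx, hy]
    | hmul x y hx hy =>
      rw [map_mul, antipode_right_mul q _ _ _ hy, hx, map_mul, map_mul, Algebra.smul_def,
        Algebra.commutes]
    | _ =>
      simp [comulHom, counitHom, antipodeLin_apply, antipodeHom, -Circle.coe_inv, -map_inv₀]
      simp only [b_mul_a, c_mul_a, ← b_mul_c, d_mul_b, d_mul_c, d_mul_a, a_mul_d, smul_smul]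
      match_scalars <;> field_simp <;> ring

/-- The opposite algebra, with complex scalars acting through complex conjugation. -/
def ConjOp : Type := (SLq q)ᵐᵒᵖ

instance : Ring (ConjOp q) := inferInstanceAs (Ring (SLq q)ᵐᵒᵖ)

/-- The identity map to the conjugate opposite algebra. -/
def toConjOp (x : SLq q) : ConjOp q := MulOpposite.op x

/-- The identity map from the conjugate opposite algebra. -/
def ofConjOp (x : ConjOp q) : SLq q := MulOpposite.unop (α := SLq q) x

instance : Algebra ℂ (ConjOp q) :=
  RingHom.toAlgebra' (S := ConjOp q)
    ((algebraMap ℂ (SLq q)ᵐᵒᵖ : ℂ →+* (SLq q)ᵐᵒᵖ).comp (starRingEnd ℂ))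
    fun z x => Algebra.commutes (A := (SLq q)ᵐᵒᵖ) (starRingEnd ℂ z) x

theorem smul_conjOp (z : ℂ) (x : SLq q) :
    z • toConjOp q x = toConjOp q (starRingEnd ℂ z • x) := by
  have h : (algebraMap ℂ (SLq q)ᵐᵒᵖ (starRingEnd ℂ z)) * MulOpposite.op x =
      MulOpposite.op (starRingEnd ℂ z • x) := by
    rw [← Algebra.smul_def, MulOpposite.op_smul]
  exact h

theorem toConjOp_mul (x y : SLq q) : toConjOp q x * toConjOp q y = toConjOp q (y * x) := rfl
theorem toConjOp_sub (x y : SLq q) : toConjOp q x - toConjOp q y = toConjOp q (x - y) := rfl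

theorem star_rels : Rels q (toConjOp q (a q)) (toConjOp q (b q)) (toConjOp q (c q))
    (toConjOp q (d q)) := by
  have hq : (q : ℂ) ≠ 0 := q.coe_ne_zero
  have hs : starRingEnd ℂ (q : ℂ) = (q : ℂ)⁻¹ := (Circle.coe_inv_eq_conj q).symm.trans
    (Circle.coe_inv q)
  have hs' : starRingEnd ℂ (q : ℂ)⁻¹ = (q : ℂ) := by
    rw [map_inv₀, hs, inv_inv]
  constructor <;>
  · simp only [toConjOp_mul, smul_conjOp, toConjOp_sub, hs, hs']
    apply congrArg (toConjOp q)
    simp only [b_mul_a, c_mul_a, ← b_mul_c, d_mul_b, d_mul_c, d_mul_a, a_mul_d, smul_smul]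
    all_goals match_scalars <;> field_simp <;> ring

/-- The antilinear antihomomorphism which fixes the four generators, as a homomorphism to the
conjugate opposite algebra. -/
def starHom : SLq q →ₐ[ℂ] ConjOp q :=
  lift q (toConjOp q (a q)) (toConjOp q (b q)) (toConjOp q (c q)) (toConjOp q (d q)) (star_rels q)

instance : Star (SLq q) := ⟨fun x => ofConjOp q (starHom q x)⟩

theorem star_def (x : SLq q) : star x = ofConjOp q (starHom q x) := rfl
@[simp] theorem star_a : star (a q) = a q := by simp [star_def, starHom]; rfl
@[simp] theorem star_b : star (b q) = b q := by simp [star_def, starHom]; rfl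
@[simp] theorem star_c : star (c q) = c q := by simp [star_def, starHom]; rfl
@[simp] theorem star_d : star (d q) = d q := by simp [star_def, starHom]; rfl

theorem star_mul_aux (x y : SLq q) : star (x * y) = star y * star x := by
  simp only [star_def, map_mul]; rfl

theorem star_add_aux (x y : SLq q) : star (x + y) = star x + star y := by
  simp only [star_def, map_add]; rfl

theorem star_algebraMap (z : ℂ) :
    star (algebraMap ℂ (SLq q) z) = algebraMap ℂ (SLq q) (starRingEnd ℂ z) := by
  simp only [star_def, AlgHom.commutes]; rfl

/-- The `*`-structure for which the four generators are real. -/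
instance : StarRing (SLq q) where
  star_mul := star_mul_aux q
  star_add := star_add_aux q
  star_involutive x := by
    induction x using induction q with
    | hz z => simp only [star_algebraMap, Complex.conj_conj]
    | hadd x y hx hy => simp only [star_add_aux, hx, hy]
    | hmul x y hx hy => simp only [star_mul_aux, hx, hy]
    | _ => simp

instance : StarModule ℂ (SLq q) where
  star_smul z x := by
    rw [Algebra.smul_def, star_mul, star_algebraMap, ← Algebra.commutes, ← Algebra.smul_def]
    rfl

/-- The antilinear map `τ = * ∘ S`. -/
def tau : SLq q →ₛₗ[starRingEnd ℂ] SLq q where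
  toFun x := star (HopfAlgebra.antipode ℂ x)
  map_add' x y := by simp
  map_smul' z x := by simp

theorem tau_apply (x : SLq q) : tau q x = star (antipodeLin q x) := rfl

theorem tau_mul (x y : SLq q) : tau q (x * y) = tau q x * tau q y := by
  simp [tau_apply, antipodeLin_mul]

theorem tau_a : tau q (a q) = d q := by
  simp [tau_apply, antipodeLin_apply, antipodeHom]
theorem tau_d : tau q (d q) = a q := by
  simp [tau_apply, antipodeLin_apply, antipodeHom]
theorem tau_b : tau q (b q) = -((q : ℂ) • b q) := by
  have hs : starRingEnd ℂ (q : ℂ)⁻¹ = (q : ℂ) := by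
    rw [map_inv₀, ← Circle.coe_inv_eq_conj, Circle.coe_inv, inv_inv]
  simp [tau_apply, antipodeLin_apply, antipodeHom, star_smul, -Circle.coe_inv, -map_inv₀,
    -star_inv₀, hs]
theorem tau_c : tau q (c q) = -((q : ℂ)⁻¹ • c q) := by
  have hs : starRingEnd ℂ (q : ℂ) = (q : ℂ)⁻¹ := (Circle.coe_inv_eq_conj q).symm.trans
    (Circle.coe_inv q)
  simp [tau_apply, antipodeLin_apply, antipodeHom, star_smul, -Circle.coe_inv, hs]

/-! Here `p` is the fixed square root of `q`, so that `q = p ^ 2`. -/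

variable (p : Circle) (μ ν : ℝ)

/-- The generator `a - d + 2 q^(1/2) μ b` of the coideal. -/
def genX : SLq (p ^ 2) := a _ - d _ + (2 * (p : ℂ) * μ) • b _

/-- The generator `q ν b + c` of the coideal. -/
def genY : SLq (p ^ 2) := ((p : ℂ) ^ 2 * ν) • b _ + c _

/-- The two-sided coideal spanned by `a - d + 2 q^(1/2) μ b` and `q ν b + c`. -/
def coideal : Submodule ℂ (SLq (p ^ 2)) := Submodule.span ℂ {genX p μ, genY p ν}

/-- The right ideal generated by the coideal. -/
def rightIdeal : Submodule ℂ (SLq (p ^ 2)) := coideal p μ ν * ⊤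

theorem mul_mem_rightIdeal {x : SLq (p ^ 2)} (hx : x ∈ rightIdeal p μ ν) (y : SLq (p ^ 2)) :
    x * y ∈ rightIdeal p μ ν := by
  have h : x * y ∈ coideal p μ ν * ⊤ * ⊤ := Submodule.mul_mem_mul hx Submodule.mem_top
  rw [mul_assoc] at h
  exact Submodule.mul_le.2 (fun m hm n _ => Submodule.mul_mem_mul hm Submodule.mem_top) h

theorem genX_mem : genX p μ ∈ coideal p μ ν := Submodule.subset_span (by simp)
theorem genY_mem : genY p ν ∈ coideal p μ ν := Submodule.subset_span (by simp)

theorem comul_genX : comulHom _ (genX p μ) =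
    genX p μ ⊗ₜ (a _ + (2 * (p : ℂ) * μ) • b _) + (d _ - (2 * (p : ℂ) * μ) • b _) ⊗ₜ genX p μ
      + b _ ⊗ₜ genY p ν - genY p ν ⊗ₜ b _ := by
  simp only [genX, genY, map_add, map_sub, map_smul, comulHom, lift_a, lift_b, lift_c, lift_d,
    TensorProduct.add_tmul, TensorProduct.tmul_add, TensorProduct.sub_tmul,
    TensorProduct.tmul_sub, ← TensorProduct.smul_tmul', TensorProduct.tmul_smul]
  module

theorem comul_genY : comulHom _ (genY p ν) =
    (a _ + (2 * (p : ℂ) * μ) • b _) ⊗ₜ genY p ν + genY p ν ⊗ₜ (d _ - (2 * (p : ℂ) * μ) • b _)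
      - genX p μ ⊗ₜ c _ + c _ ⊗ₜ genX p μ := by
  simp only [genX, genY, map_add, map_sub, map_smul, comulHom, lift_a, lift_b, lift_c, lift_d,
    TensorProduct.add_tmul, TensorProduct.tmul_add, TensorProduct.sub_tmul,
    TensorProduct.tmul_sub, ← TensorProduct.smul_tmul', TensorProduct.tmul_smul]
  module

theorem map_mkQ_tmul_mul {I : Submodule ℂ (SLq q)} {x y : SLq q}
    (h : (∀ z, x * z ∈ I) ∨ ∀ z, y * z ∈ I) (T : SLq q ⊗[ℂ] SLq q) :
    TensorProduct.map I.mkQ I.mkQ (x ⊗ₜ y * T) = 0 := by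
  induction T with
  | zero => simp
  | add T U hT hU => rw [mul_add, map_add, hT, hU, add_zero]
  | tmul u v =>
    rw [Algebra.TensorProduct.tmul_mul_tmul, TensorProduct.map_tmul]
    rcases h with h | h
    · rw [I.mkQ_apply (x * u), (Submodule.Quotient.mk_eq_zero I).2 (h u), TensorProduct.zero_tmul]
    · rw [I.mkQ_apply (y * v), (Submodule.Quotient.mk_eq_zero I).2 (h v), TensorProduct.tmul_zero]

instance : (rightIdeal p μ ν).IsCoideal where
  counit_eq_zero x hx := by
    rw [counit_def]
    induction hx using Submodule.mul_induction_on' with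
    | add x _ y _ hx hy => rw [map_add, hx, hy, add_zero]
    | mem_mul_mem m hm n _ =>
      rw [map_mul]
      have : counitHom _ m = 0 := by
        induction hm using Submodule.span_induction with
        | mem x hx => rcases hx with rfl | rfl <;> simp [genX, genY, counitHom]
        | zero => simp
        | add x y _ _ hx hy => simp [hx, hy]
        | smul z x _ hx => simp [hx]
      rw [this, zero_mul]
  map_mkQ_comul_eq_zero x hx := by
    rw [comul_def]
    have hX : ∀ z, genX p μ * z ∈ rightIdeal p μ ν := fun z =>
      Submodule.mul_mem_mul (genX_mem p μ ν) Submodule.mem_top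
    have hY : ∀ z, genY p ν * z ∈ rightIdeal p μ ν := fun z =>
      Submodule.mul_mem_mul (genY_mem p μ ν) Submodule.mem_top
    induction hx using Submodule.mul_induction_on' with
    | add x _ y _ hx hy => rw [map_add, map_add, hx, hy, add_zero]
    | mem_mul_mem m hm n _ =>
      rw [map_mul]
      generalize comulHom _ n = T
      induction hm using Submodule.span_induction with
      | mem x hx =>
        rcases hx with rfl | rfl
        · rw [comul_genX p μ ν]
          simp only [add_mul, sub_mul, map_add, map_sub, map_mkQ_tmul_mul _ (Or.inl hX),
            map_mkQ_tmul_mul _ (Or.inr hX), map_mkQ_tmul_mul _ (Or.inl hY),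
            map_mkQ_tmul_mul _ (Or.inr hY), add_zero, sub_zero]
        · rw [comul_genY p μ ν]
          simp only [add_mul, sub_mul, map_add, map_sub, map_mkQ_tmul_mul _ (Or.inl hX),
            map_mkQ_tmul_mul _ (Or.inr hX), map_mkQ_tmul_mul _ (Or.inl hY),
            map_mkQ_tmul_mul _ (Or.inr hY), add_zero, sub_zero]
      | zero => simp
      | add x y _ _ hx hy => rw [map_add, add_mul, map_add, hx, hy, add_zero]
      | smul z x _ hx => rw [map_smul, smul_mul_assoc, map_smul, hx, smul_zero]

theorem tau_genX : tau _ (genX p μ) = -genX p μ := by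
  have hp : (p : ℂ) ≠ 0 := p.coe_ne_zero
  have hs : starRingEnd ℂ (p : ℂ) = (p : ℂ)⁻¹ := (Circle.coe_inv_eq_conj p).symm.trans
    (Circle.coe_inv p)
  simp only [genX, map_add, map_sub, LinearMap.map_smulₛₗ, tau_a, tau_b, tau_d, map_mul, hs,
    Complex.conj_ofReal, map_ofNat, Circle.coe_pow]
  match_scalars <;> field_simp

theorem tau_genY : tau _ (genY p ν) = -(((p : ℂ) ^ 2)⁻¹ • genY p ν) := by
  have hp : (p : ℂ) ≠ 0 := p.coe_ne_zero
  have hs : starRingEnd ℂ (p : ℂ) = (p : ℂ)⁻¹ := (Circle.coe_inv_eq_conj p).symm.trans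
    (Circle.coe_inv p)
  simp only [genY, map_add, LinearMap.map_smulₛₗ, tau_b, tau_c, map_mul, map_pow, hs,
    Complex.conj_ofReal, Circle.coe_pow]
  match_scalars <;> field_simp

theorem rightIdeal_le_comap_tau :
    rightIdeal p μ ν ≤ (rightIdeal p μ ν).comap (tau (p ^ 2)) := by
  refine Submodule.mul_le.2 fun m hm n _ => ?_
  rw [Submodule.mem_comap, tau_mul]
  refine Submodule.mul_mem_mul ?_ Submodule.mem_top
  induction hm using Submodule.span_induction with
  | mem x hx =>
    rcases hx with rfl | rfl
    · rw [tau_genX]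
      exact neg_mem (genX_mem p μ ν)
    · rw [tau_genY]
      exact neg_mem (Submodule.smul_mem _ _ (genY_mem p μ ν))
  | zero => simp
  | add x y _ _ hx hy => rw [map_add]; exact add_mem hx hy
  | smul z x _ hx => rw [LinearMap.map_smulₛₗ]; exact Submodule.smul_mem _ _ hx

end SLq

open SLq

/-- The right coisotropic quantum subgroup `K_{μν}`, the quotient of `SL_q(2, ℝ)`, `q = p ^ 2`, by
the right ideal generated by `a - d + 2 q^(1/2) μ b` and `q ν b + c`, with `q^(1/2) = p`.
Its coalgebra structure is that of the quotient by a coideal. -/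
abbrev CoisoK (p : Circle) (μ ν : ℝ) : Type := SLq (p ^ 2) ⧸ rightIdeal p μ ν

namespace CoisoK

variable (p : Circle) (μ ν : ℝ)

/-- The quotient map `r_{μν}`. -/
def proj : SLq (p ^ 2) →ₗ[ℂ] CoisoK p μ ν := (rightIdeal p μ ν).mkQ

/-- The right action of `x`: it sends `r[y]` to `r[y] · x = r[y x]`. -/
def act (x : SLq (p ^ 2)) : CoisoK p μ ν →ₗ[ℂ] CoisoK p μ ν :=
  (rightIdeal p μ ν).mapQ (rightIdeal p μ ν) (LinearMap.mulRight ℂ x)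
    fun _ hy => mul_mem_rightIdeal p μ ν hy x

/-- The antilinear map induced by `τ = * ∘ S`: it sends `r[x]` to `r[τ x]`. -/
def tau : CoisoK p μ ν →ₛₗ[starRingEnd ℂ] CoisoK p μ ν :=
  (rightIdeal p μ ν).mapQ (rightIdeal p μ ν) (SLq.tau (p ^ 2)) (rightIdeal_le_comap_tau p μ ν)

theorem tau_proj (x : SLq (p ^ 2)) :
    tau p μ ν (proj p μ ν x) = proj p μ ν (SLq.tau _ x) := rfl

theorem act_proj (x y : SLq (p ^ 2)) :
    act p μ ν x (proj p μ ν y) = proj p μ ν (y * x) := rfl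

theorem comul_proj (x : SLq (p ^ 2)) :
    Coalgebra.comul (R := ℂ) (proj p μ ν x) =
      TensorProduct.map (proj p μ ν) (proj p μ ν) (Coalgebra.comul x) := rfl

theorem counit_proj (x : SLq (p ^ 2)) :
    Coalgebra.counit (R := ℂ) (proj p μ ν x) = Coalgebra.counit (R := ℂ) x := rfl

end CoisoK

/-- The coalgebra `R_q`, which is `K_{μν}` for `ν = μ ^ 2`. -/
abbrev Rq (p : Circle) (μ : ℝ) : Type := CoisoK p μ (μ ^ 2)

namespace Rq

variable (p : Circle) (μ : ℝ)

/-- `w_n = (a + q^(1/2) μ b) (a + q^(3/2) μ b) ⋯ (a + q^(n - 1/2) μ b)`, where `q^(1/2) = p`. -/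
def w : ℕ → SLq (p ^ 2)
  | 0 => 1
  | n + 1 => w n * (a _ + ((p : ℂ) ^ (2 * n + 1) * μ) • b _)

/-- The element `v_n` of `R_q`, the class of `w_n`. -/
def v (n : ℕ) : Rq p μ := CoisoK.proj p μ (μ ^ 2) (w p μ n)

/-- The `q`-number `[n]_q = (q^n - q^(-n)) / (q - q^(-1))`. -/
def qNum (q : ℂ) (n : ℕ) : ℂ := (q ^ n - (q ^ n)⁻¹) / (q - q⁻¹)

/-- The `q`-factorial `[n]_q! = [1]_q [2]_q ⋯ [n]_q`. -/
def qFact (q : ℂ) (n : ℕ) : ℂ := ∏ i ∈ Finset.Icc 1 n, qNum q i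

/-- The element
`X_n = ∑_{i=1}^n (q - q⁻¹)^(i-1) q^(i/2) μ^i [n-1]_q! / ([i]_q [n-i]_q!) v_{n-i} · b^i`
of `R_q`, where `q = p ^ 2` and `q^(1/2) = p`; it is used for `n ≥ 1`. -/
def X (n : ℕ) : Rq p μ :=
  ∑ i ∈ Finset.Icc 1 n,
    (((p : ℂ) ^ 2 - ((p : ℂ) ^ 2)⁻¹) ^ (i - 1) * (p : ℂ) ^ i * (μ : ℂ) ^ i *
        qFact ((p : ℂ) ^ 2) (n - 1) / (qNum ((p : ℂ) ^ 2) i * qFact ((p : ℂ) ^ 2) (n - i))) •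
      CoisoK.act p μ (μ ^ 2) (b (p ^ 2) ^ i) (v p μ (n - i))

end Rq

end

/-! ### Generalized characters of the quotient coalgebra -/

noncomputable section

open SLq

namespace CoisoK

variable {p : Circle} {μ ν : ℝ}

/-! Call `r[x]` a character of weight `(β, γ)` if on it `c` acts as `-βγ b` and `d` as `a + (β + γ)
b`. On such a vector the matrix coproduct of `a + β b` becomes `(a + β b) ⊗ (a + β b)`, so
multiplication by `a + β b` keeps it group-like and moves its weight to `(qβ, q⁻¹γ)`
(`IsTangent.step`, `IsTangent.comul_self_step`). Since `ν = μ²`, the class of `1` is a group-like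
character with the double weight `β = γ = q^(1/2) μ`. Raising it gives the `v_n`.

Because the weight is double, raising and lowering from `r[1]` coincide, and the `v_n` alone do not
suffice. The missing vectors are the derivatives `T_n` of `v_n` under `(β, γ) ↦ (e^ε β, e^(-ε) γ)`,
which fixes `βγ`. Differentiating `Δ v = v ⊗ v` gives `Δ T = T ⊗ v + v ⊗ T`. Expanding the
derivative in powers of `b` gives `T_n = [n]_q X_n` (`T_eq`), and `[n]_q` is real and nonzero for `n
≥ 1`.

Independence: a two-dimensional representation shows that the `v_n` are distinct, and distinct
group-like elements are independent. Convolution with functionals dual to the `v_n` then separates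
the `T_n` by weight and shows that a nonzero skew-primitive element is never in the span of the
`v_n`. Spanning: raising and lowering operators differ by a multiple of `b`, so `b`, and then `a`,
`c`, `d`, preserve the span of all `v_n` and `T_n`, which contains the cyclic vector `r[1]`. -/

theorem proj_mul_congr {x x' : SLq (p ^ 2)} (h : proj p μ ν x = proj p μ ν x')
    (y : SLq (p ^ 2)) : proj p μ ν (x * y) = proj p μ ν (x' * y) := by
  rw [← act_proj, h, act_proj]

theorem proj_genX_mul (y : SLq (p ^ 2)) : proj p μ ν (genX p μ * y) = 0 :=
  (Submodule.Quotient.mk_eq_zero _).2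
    (Submodule.mul_mem_mul (genX_mem p μ ν) Submodule.mem_top)

theorem proj_genY_mul (y : SLq (p ^ 2)) : proj p μ ν (genY p ν * y) = 0 :=
  (Submodule.Quotient.mk_eq_zero _).2
    (Submodule.mul_mem_mul (genY_mem p μ ν) Submodule.mem_top)

/-- Makes the quotient a right module coalgebra: the coproduct of `r[x a]` or `r[x b]` is determined
by that of `r[x]`. -/
theorem map_proj_mul_tmul (U : SLq (p ^ 2) ⊗[ℂ] SLq (p ^ 2)) (y z : SLq (p ^ 2)) :
    TensorProduct.map (proj p μ ν) (proj p μ ν) (U * y ⊗ₜ z) =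
      TensorProduct.map (act p μ ν y) (act p μ ν z)
        (TensorProduct.map (proj p μ ν) (proj p μ ν) U) := by
  induction U with
  | zero => simp
  | add U V hU hV => simp only [add_mul, map_add, hU, hV]
  | tmul u v => simp [act_proj]

theorem comul_proj_mul_a (x : SLq (p ^ 2)) :
    Coalgebra.comul (R := ℂ) (proj p μ ν (x * a _)) =
      TensorProduct.map (act p μ ν (a _)) (act p μ ν (a _)) (Coalgebra.comul (proj p μ ν x)) +
      TensorProduct.map (act p μ ν (b _)) (act p μ ν (c _)) (Coalgebra.comul (proj p μ ν x)) := by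
  simp only [comul_proj, comul_def, map_mul, ← map_proj_mul_tmul, ← map_add, ← mul_add]
  simp [comulHom]

theorem comul_proj_mul_b (x : SLq (p ^ 2)) :
    Coalgebra.comul (R := ℂ) (proj p μ ν (x * b _)) =
      TensorProduct.map (act p μ ν (a _)) (act p μ ν (b _)) (Coalgebra.comul (proj p μ ν x)) +
      TensorProduct.map (act p μ ν (b _)) (act p μ ν (d _)) (Coalgebra.comul (proj p μ ν x)) := by
  simp only [comul_proj, comul_def, map_mul, ← map_proj_mul_tmul, ← map_add, ← mul_add]
  simp [comulHom]

variable (p μ ν) in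
/-- The vector `r[t]` is a generalized character of `K_{μν}`, tangent to `r[x]`: the elements `c`
and `d - a - (β + γ) b` act on it through multiples of the action of `b` on `r[t]` and `r[x]`.
For `x = 0` the vector `r[t]` is a character of weight `(β, γ)`. -/
structure IsTangent (β γ : ℂ) (t x : SLq (p ^ 2)) : Prop where
  mul_c : proj p μ ν (t * c _) = -(β * γ) • proj p μ ν (t * b _)
  mul_d : proj p μ ν (t * d _) = proj p μ ν (t * a _) + (β + γ) • proj p μ ν (t * b _)
    + (β - γ) • proj p μ ν (x * b _)

namespace IsTangent

variable {β γ : ℂ} {t x : SLq (p ^ 2)}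

/-- The quadratic relation `1 = d a - q⁻¹ b c` on a generalized character. -/
theorem proj_eq (ht : IsTangent p μ ν β γ t x) :
    proj p μ ν t = proj p μ ν (t * a _ * a _)
      + ((β + γ) * ((p : ℂ) ^ 2)⁻¹) • proj p μ ν (t * a _ * b _)
      + ((β - γ) * ((p : ℂ) ^ 2)⁻¹) • proj p μ ν (x * a _ * b _)
      + (((p : ℂ) ^ 2)⁻¹ * (β * γ)) • proj p μ ν (t * b _ * b _) := by
  have hd : proj p μ ν (t * d _ * a _) = proj p μ ν ((t * a _ + (β + γ) • (t * b _)
      + (β - γ) • (x * b _)) * a _) := proj_mul_congr (by simpa using ht.mul_d) _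
  have hc : proj p μ ν (t * c _ * b _) = proj p μ ν ((-(β * γ) • (t * b _)) * b _) :=
    proj_mul_congr (by simpa using ht.mul_c) _
  have h1 : t = t * d _ * a _ - ((p : ℂ) ^ 2)⁻¹ • (t * c _ * b _) := by
    rw [mul_assoc, d_mul_a, mul_assoc, ← b_mul_c]
    simp [mul_add]
  conv_lhs => rw [h1]
  simp only [add_mul, smul_mul_assoc, mul_assoc, b_mul_a, Circle.coe_pow, mul_smul_comm,
    map_add, map_sub, map_smul] at hd hc ⊢
  rw [hd, hc]
  module

/-- Raising of a character together with its tangent vector. With `β' = β` and `γ' = -γ`, the new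
first vector is the derivative of `x (a + β b)` by the product rule. -/
theorem step (ht : IsTangent p μ ν β γ t x) (hx : IsTangent p μ ν β γ x 0) :
    IsTangent p μ ν ((p : ℂ) ^ 2 * β) (((p : ℂ) ^ 2)⁻¹ * γ)
      (t * (a _ + β • b _) + β • (x * b _)) (x * (a _ + β • b _)) := by
  have hp : (p : ℂ) ≠ 0 := p.coe_ne_zero
  have htc : ∀ y, proj p μ ν (t * (c _ * y)) = proj p μ ν ((-(β * γ) • (t * b _)) * y) :=
    fun y => by rw [← mul_assoc]; exact proj_mul_congr (by simpa using ht.mul_c) _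
  have hxc : ∀ y, proj p μ ν (x * (c _ * y)) = proj p μ ν ((-(β * γ) • (x * b _)) * y) :=
    fun y => by rw [← mul_assoc]; exact proj_mul_congr (by simpa using hx.mul_c) _
  have htd : ∀ y, proj p μ ν (t * (d _ * y)) = proj p μ ν ((t * a _ + (β + γ) • (t * b _)
      + (β - γ) • (x * b _)) * y) :=
    fun y => by rw [← mul_assoc]; exact proj_mul_congr (by simpa using ht.mul_d) _
  have hxd : ∀ y, proj p μ ν (x * (d _ * y)) = proj p μ ν ((x * a _ + (β + γ) • (x * b _)) * y) :=
    fun y => by rw [← mul_assoc]; exact proj_mul_congr (by simpa using hx.mul_d) _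
  have h1 := ht.proj_eq
  have h2 := hx.proj_eq
  constructor
  · simp only [add_mul, mul_add, smul_mul_assoc, mul_assoc, mul_smul_comm, b_mul_a, b_mul_c,
      a_mul_c, Circle.coe_pow, map_add, map_sub, map_smul, htc, hxc]
    match_scalars <;> field_simp <;> ring
  · simp only [add_mul, mul_add, smul_mul_assoc, mul_assoc, mul_smul_comm, b_mul_a, b_mul_d,
      a_mul_d, b_mul_c, Circle.coe_pow, map_add, map_sub, map_smul, htc, hxc, htd, hxd, mul_one,
      zero_mul, map_zero, smul_zero, add_zero] at h1 h2 ⊢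
    -- The relation `a d = 1 + q b c` leaves a bare `r[t]`. The quadratic relation turns it into
    -- terms of degree two, so that both sides are combinations of the same monomials.
    rw [h1]
    match_scalars <;> field_simp <;> ring

/-- Lowering a generalized character. -/
theorem step_back (ht : IsTangent p μ ν β γ t x) :
    proj p μ ν ((t * (a _ + β • b _) + β • (x * b _)) * (a _ + (((p : ℂ) ^ 2)⁻¹ * γ) • b _)) =
      proj p μ ν t + (((p : ℂ) ^ 2)⁻¹ * γ) • proj p μ ν (x * (a _ + β • b _) * b _) := by
  have hp : (p : ℂ) ≠ 0 := p.coe_ne_zero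
  have h1 := ht.proj_eq
  simp only [add_mul, mul_add, smul_mul_assoc, mul_assoc, mul_smul_comm, b_mul_a,
    Circle.coe_pow, map_add, map_sub, map_smul] at h1 ⊢
  rw [h1]
  match_scalars <;> field_simp <;> ring

/-- The derivative of `comul_self_step`. There `a ⊗ a + b ⊗ c + β (a ⊗ b + b ⊗ d)` becomes a tensor
square once `c` and `d` are expressed through `a` and `b`. -/
theorem comul_step (ht : IsTangent p μ ν β γ t x) (hx : IsTangent p μ ν β γ x 0)
    (hxx : Coalgebra.comul (R := ℂ) (proj p μ ν x) = proj p μ ν x ⊗ₜ proj p μ ν x)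
    (htx : Coalgebra.comul (R := ℂ) (proj p μ ν t) =
      proj p μ ν t ⊗ₜ proj p μ ν x + proj p μ ν x ⊗ₜ proj p μ ν t) :
    Coalgebra.comul (R := ℂ) (proj p μ ν (t * (a _ + β • b _) + β • (x * b _))) =
      proj p μ ν (t * (a _ + β • b _) + β • (x * b _)) ⊗ₜ proj p μ ν (x * (a _ + β • b _)) +
      proj p μ ν (x * (a _ + β • b _)) ⊗ₜ proj p μ ν (t * (a _ + β • b _) + β • (x * b _)) := by
  simp only [mul_add, mul_smul_comm, map_add, map_smul, comul_proj_mul_a, comul_proj_mul_b, hxx,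
    htx, TensorProduct.map_tmul, act_proj, ht.mul_c, ht.mul_d, hx.mul_c, hx.mul_d,
    TensorProduct.add_tmul, TensorProduct.tmul_add, ← TensorProduct.smul_tmul',
    TensorProduct.tmul_smul, smul_smul, zero_mul, map_zero, smul_zero, add_zero]
  module

theorem comul_self_step (hx : IsTangent p μ ν β γ x 0)
    (hxx : Coalgebra.comul (R := ℂ) (proj p μ ν x) = proj p μ ν x ⊗ₜ proj p μ ν x) :
    Coalgebra.comul (R := ℂ) (proj p μ ν (x * (a _ + β • b _))) =
      proj p μ ν (x * (a _ + β • b _)) ⊗ₜ proj p μ ν (x * (a _ + β • b _)) := by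
  simp only [mul_add, mul_smul_comm, map_add, map_smul, comul_proj_mul_a, comul_proj_mul_b, hxx,
    TensorProduct.map_tmul, act_proj, hx.mul_c, hx.mul_d,
    TensorProduct.add_tmul, TensorProduct.tmul_add, ← TensorProduct.smul_tmul',
    TensorProduct.tmul_smul, smul_smul, zero_mul, map_zero, smul_zero, add_zero]
  module

end IsTangent

end CoisoK

/-! ### The group-like elements and their derivatives -/

namespace Rq

variable (p : Circle) (μ : ℝ)

open CoisoK

/-- The coideal prescribes `β + γ = 2 q^(1/2) μ` and `βγ = q ν`. For `ν = μ²` this has the double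
root `q^(1/2) μ`. -/
theorem isTangent_one : IsTangent p μ (μ ^ 2) (p * μ) (p * μ) 1 0 := by
  have hX := proj_genX_mul (p := p) (μ := μ) (ν := μ ^ 2) 1
  have hY := proj_genY_mul (p := p) (μ := μ) (ν := μ ^ 2) 1
  simp only [genX, genY, mul_one, map_add, map_sub, map_smul] at hX hY
  push_cast at hY
  constructor
  · rw [one_mul, one_mul, ← sub_eq_zero, ← hY]; module
  · rw [one_mul, one_mul, ← sub_eq_zero, ← neg_eq_zero, ← hX]; simp; module

/-- The weights of the characters: `β_n = q^n q^(1/2) μ`. -/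
def up (n : ℕ) : ℂ := ((p : ℂ) ^ 2) ^ n * (p * μ)

/-- The weights of the characters: `γ_n = q^(-n) q^(1/2) μ`. -/
def down (n : ℕ) : ℂ := (((p : ℂ) ^ 2) ^ n)⁻¹ * (p * μ)

theorem up_succ (n : ℕ) : up p μ (n + 1) = (p : ℂ) ^ 2 * up p μ n := by
  unfold up; ring

theorem down_succ (n : ℕ) : down p μ (n + 1) = ((p : ℂ) ^ 2)⁻¹ * down p μ n := by
  unfold down; rw [pow_succ, mul_inv]; ring

theorem w_succ (n : ℕ) : w p μ (n + 1) = w p μ n * (a _ + up p μ n • b _) := by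
  rw [w, up]; congr 3; ring

theorem isTangent_w (n : ℕ) : IsTangent p μ (μ ^ 2) (up p μ n) (down p μ n) (w p μ n) 0 := by
  induction n with
  | zero => simpa [up, down, w] using isTangent_one p μ
  | succ n ih =>
    have h0 : IsTangent p μ (μ ^ 2) (up p μ n) (down p μ n) 0 0 := by constructor <;> simp
    simpa [up_succ, down_succ, w_succ] using ih.step h0

/-- The derivative of `w_n` along the family of characters. -/
def t : ℕ → SLq (p ^ 2)
  | 0 => 0
  | n + 1 => t n * (a _ + up p μ n • b _) + up p μ n • (w p μ n * b _)

/-- The derivative of `v_n` along the family of characters; it is `[n]_q X_n`. -/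
def T (n : ℕ) : Rq p μ := proj p μ (μ ^ 2) (t p μ n)

theorem isTangent_t (n : ℕ) :
    IsTangent p μ (μ ^ 2) (up p μ n) (down p μ n) (t p μ n) (w p μ n) := by
  induction n with
  -- The zero vector is tangent to `r[1]` because the factor `β - γ` vanishes at the double weight.
  | zero => constructor <;> simp [t, up, down]
  | succ n ih =>
    rw [up_succ, down_succ, w_succ]
    exact ih.step (isTangent_w p μ n)

theorem isGroupLikeElem_v (n : ℕ) : IsGroupLikeElem ℂ (v p μ n) where
  counit_eq_one := by
    rw [v, counit_proj, counit_def]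
    induction n with
    | zero => simp [w]
    | succ n ih => rw [w_succ, map_mul, ih]; simp [counitHom]
  comul_eq_tmul_self := by
    unfold v
    induction n with
    | zero => simp [w, comul_proj, Algebra.TensorProduct.one_def]
    | succ n ih =>
      rw [w_succ]
      exact (isTangent_w p μ n).comul_self_step ih

theorem comul_T (n : ℕ) :
    Coalgebra.comul (R := ℂ) (T p μ n) = T p μ n ⊗ₜ v p μ n + v p μ n ⊗ₜ T p μ n := by
  unfold T
  induction n with
  | zero => simp [t]
  | succ n ih =>
    rw [v, w_succ, t]
    exact (isTangent_t p μ n).comul_step (isTangent_w p μ n)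
      (isGroupLikeElem_v p μ n).comul_eq_tmul_self ih

theorem conj_up (n : ℕ) : starRingEnd ℂ (up p μ n) = ((p : ℂ) ^ 2)⁻¹ * down p μ n := by
  have hp : (p : ℂ) ≠ 0 := p.coe_ne_zero
  have hs : starRingEnd ℂ (p : ℂ) = (p : ℂ)⁻¹ := (Circle.coe_inv_eq_conj p).symm.trans
    (Circle.coe_inv p)
  simp only [up, down, map_mul, map_pow, hs, Complex.conj_ofReal, inv_pow]
  field_simp

theorem tau_mul_step (n : ℕ) : SLq.tau (p ^ 2) (a _ + up p μ n • b _) =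
    d _ - down p μ n • b _ := by
  have hp : (p : ℂ) ≠ 0 := p.coe_ne_zero
  rw [map_add, LinearMap.map_smulₛₗ, tau_a, tau_b, conj_up]
  match_scalars
  · simp
  · simp; field_simp

/-- The map `τ` turns the factor `a + β_n b` into `d - γ_n b`, which acts on `v_n` as `a + β_n b`
again. -/
theorem tau_v (n : ℕ) : CoisoK.tau p μ (μ ^ 2) (v p μ n) = v p μ n := by
  rw [v, tau_proj]
  induction n with
  | zero => simp [w, tau_apply, antipodeLin_apply]
  | succ n ih =>
    rw [w_succ, SLq.tau_mul, proj_mul_congr ih, tau_mul_step]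
    simp only [mul_sub, mul_add, mul_smul_comm, map_sub, map_add, map_smul,
      (isTangent_w p μ n).mul_d, zero_mul, map_zero, smul_zero]
    module

/-- As for `tau_v`, on `-T_n`: the action of `d` now adds `-(β_n - γ_n) v_n · b`, and `τ` of the
last term of `t (n + 1)` is `-γ_n v_n · b`. Together they give the required `-β_n v_n · b`. -/
theorem tau_T (n : ℕ) : CoisoK.tau p μ (μ ^ 2) (T p μ n) = -T p μ n := by
  have hp : (p : ℂ) ≠ 0 := p.coe_ne_zero
  rw [T, tau_proj]
  induction n with
  | zero => simp [t]
  | succ n ih =>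
    have hv := tau_v p μ n
    rw [v, tau_proj] at hv
    rw [← map_neg] at ih
    rw [t, map_add, LinearMap.map_smulₛₗ, SLq.tau_mul, SLq.tau_mul, tau_mul_step, conj_up,
      map_add, map_smul, proj_mul_congr ih, proj_mul_congr hv, tau_b]
    simp only [mul_sub, mul_add, mul_smul_comm, neg_mul, mul_neg, map_neg, map_sub, map_add,
      map_smul, (isTangent_t p μ n).mul_d, Circle.coe_pow]
    match_scalars <;> field_simp <;> ring

end Rq

end

/-! ### `q`-numbers and the expansion of the derivatives in powers of `b` -/

noncomputable section

open SLq CoisoK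

namespace Rq

theorem pow_sub_inv_ne_zero {Q : ℂ} (hQ : ∀ n : ℕ, 0 < n → Q ^ n ≠ 1) (h0 : Q ≠ 0) {n : ℕ}
    (hn : 0 < n) : Q ^ n - (Q ^ n)⁻¹ ≠ 0 := by
  intro h
  refine hQ (n + n) (by omega) ?_
  rw [pow_add]
  nth_rewrite 2 [sub_eq_zero.1 h]
  exact mul_inv_cancel₀ (pow_ne_zero n h0)

theorem qNum_ne_zero {Q : ℂ} (hQ : ∀ n : ℕ, 0 < n → Q ^ n ≠ 1) (h0 : Q ≠ 0) {n : ℕ}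
    (hn : 0 < n) : qNum Q n ≠ 0 :=
  div_ne_zero (pow_sub_inv_ne_zero hQ h0 hn) (by simpa using pow_sub_inv_ne_zero hQ h0 one_pos)

theorem qFact_ne_zero {Q : ℂ} (hQ : ∀ n : ℕ, 0 < n → Q ^ n ≠ 1) (h0 : Q ≠ 0) (n : ℕ) :
    qFact Q n ≠ 0 :=
  Finset.prod_ne_zero_iff.2 fun _ hi => qNum_ne_zero hQ h0 (Finset.mem_Icc.1 hi).1

theorem qFact_succ (Q : ℂ) (n : ℕ) : qFact Q (n + 1) = qFact Q n * qNum Q (n + 1) := by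
  rw [qFact, qFact, Finset.prod_Icc_succ_top (by omega)]

/-- The addition rule for `q`-numbers. -/
theorem qNum_add {Q : ℂ} (h0 : Q ≠ 0) (m n : ℕ) :
    qNum Q (m + n) = (Q ^ n)⁻¹ * qNum Q m + Q ^ m * qNum Q n := by
  unfold qNum
  rw [← mul_div_assoc, ← mul_div_assoc, ← add_div, pow_add]
  congr 1
  field_simp
  ring

/-- Conjugation inverts `q`, which changes the sign of both numerator and denominator. -/
theorem conj_qNum (q : Circle) (n : ℕ) : starRingEnd ℂ (qNum q n) = qNum q n := by
  have hs : starRingEnd ℂ (q : ℂ) = (q : ℂ)⁻¹ := (Circle.coe_inv_eq_conj q).symm.trans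
    (Circle.coe_inv q)
  simp only [qNum, map_div₀, map_sub, map_inv₀, map_pow, hs, inv_pow, inv_inv]
  rw [← neg_sub, ← neg_sub (q : ℂ), neg_div_neg_eq]

variable {p : Circle} {μ : ℝ}

theorem b_pow_mul_a (q : Circle) (i : ℕ) : b q ^ i * a q = ((q : ℂ) ^ i)⁻¹ • (a q * b q ^ i) := by
  induction i with
  | zero => simp
  | succ i ih =>
    rw [pow_succ', mul_assoc, ih, mul_smul_comm, ← mul_assoc, b_mul_a, smul_mul_assoc, smul_smul,
      mul_assoc, pow_succ, mul_inv]

/-- Moving `a` to the left of `b ^ i` costs `q^(-i)`. Completing `w_m a` to `w_(m+1)` leaves the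
multiple of `b ^ (i + 1)`. -/
theorem w_mul_b_pow_mul (m i : ℕ) (β : ℂ) :
    w p μ m * b _ ^ i * (a _ + β • b _) = (((p : ℂ) ^ 2) ^ i)⁻¹ • (w p μ (m + 1) * b _ ^ i) +
      (β - (((p : ℂ) ^ 2) ^ i)⁻¹ * up p μ m) • (w p μ m * b _ ^ (i + 1)) := by
  rw [w_succ, mul_add, mul_assoc, b_pow_mul_a]
  simp only [mul_add, add_mul, mul_smul_comm, smul_mul_assoc, mul_assoc, pow_succ' (b (p ^ 2)),
    (Commute.refl (b (p ^ 2))).pow_left i |>.eq, Circle.coe_pow]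
  module

variable (p μ) in
/-- The coefficients of the expansion of `t_n`. -/
def tCoeff (n j : ℕ) : ℂ :=
  ((p : ℂ) ^ 2 - ((p : ℂ) ^ 2)⁻¹) ^ j * (p * μ) ^ (j + 1) * qFact ((p : ℂ) ^ 2) n /
    (qNum ((p : ℂ) ^ 2) (j + 1) * qFact ((p : ℂ) ^ 2) (n - 1 - j))

/-- Holds already in the algebra, before passing to the quotient. The induction is a Pascal-type
recursion whose two contributions recombine by the addition rule for `q`-numbers. -/
theorem t_eq_sum (hp : ∀ n : ℕ, 0 < n → ((p : ℂ) ^ 2) ^ n ≠ 1) (n : ℕ) :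
    t p μ n = ∑ j ∈ Finset.range n, tCoeff p μ n j • (w p μ (n - 1 - j) * b _ ^ (j + 1)) := by
  have h0 : (p : ℂ) ≠ 0 := p.coe_ne_zero
  have h2 : (p : ℂ) ^ 2 ≠ 0 := pow_ne_zero 2 h0
  have hN {k : ℕ} (hk : 0 < k) := qNum_ne_zero hp h2 hk
  have hF := qFact_ne_zero hp h2
  induction n with
  | zero => simp [t]
  | succ n ih =>
    set f : ℕ → SLq (p ^ 2) := fun j => w p μ (n - j) * b _ ^ (j + 1) with hf
    -- `A j` is the part of the coefficient of `f j` coming from the terms that keep their power of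
    -- `b`. `E j` is the part coming from a power raised by one or, for `j = 0`, from the new term
    -- `β_n w_n b`.
    let K (j : ℕ) : ℂ := ((p : ℂ) ^ 2 - ((p : ℂ) ^ 2)⁻¹) ^ j * (p * μ) ^ (j + 1) *
      qFact ((p : ℂ) ^ 2) n / qFact ((p : ℂ) ^ 2) (n - j)
    let A (j : ℕ) : ℂ := K j * ((((p : ℂ) ^ 2) ^ (j + 1))⁻¹ * qNum ((p : ℂ) ^ 2) (n - j) /
      qNum ((p : ℂ) ^ 2) (j + 1))
    let E (j : ℕ) : ℂ := K j * ((p : ℂ) ^ 2) ^ (n - j)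
    have hstep : ∀ j ∈ Finset.range n,
        tCoeff p μ n j • (w p μ (n - 1 - j) * b _ ^ (j + 1)) * (a _ + up p μ n • b _) =
          A j • f j + E (j + 1) • f (j + 1) := by
      intro j hj
      obtain ⟨m, rfl⟩ : ∃ m, n = m + 1 + j := ⟨n - 1 - j, by
        have := Finset.mem_range.1 hj; omega⟩
      have e1 : m + 1 + j - 1 - j = m := by omega
      have e2 : m + 1 + j - j = m + 1 := by omega
      have e3 : m + 1 + j - (j + 1) = m := by omega
      have hFm := hF m
      have hNm := hN m.succ_pos
      have hNj := hN j.succ_pos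
      have hd : (p : ℂ) ^ 2 - ((p : ℂ) ^ 2)⁻¹ ≠ 0 := by
        simpa using pow_sub_inv_ne_zero hp h2 one_pos
      rw [smul_mul_assoc, w_mul_b_pow_mul]
      simp only [hf, A, E, K, tCoeff, e1, e2, e3, smul_add, smul_smul, qFact_succ _ m]
      congr 2
      · field_simp
      · have hj' : ((p : ℂ) ^ 2) ^ (j + 1) - (((p : ℂ) ^ 2) ^ (j + 1))⁻¹ =
            qNum ((p : ℂ) ^ 2) (j + 1) * ((p : ℂ) ^ 2 - ((p : ℂ) ^ 2)⁻¹) := by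
          rw [qNum, div_mul_cancel₀ _ hd]
        -- The excess weight contains `[j+1]_q (q - q⁻¹)`. It cancels the denominator and supplies
        -- one more power of `q - q⁻¹`.
        have hu : up p μ (m + 1 + j) - (((p : ℂ) ^ 2) ^ (j + 1))⁻¹ * up p μ m =
            (p * μ) * ((p : ℂ) ^ 2) ^ m * (qNum ((p : ℂ) ^ 2) (j + 1) *
              ((p : ℂ) ^ 2 - ((p : ℂ) ^ 2)⁻¹)) := by
          rw [← hj', up, up]; ring
        rw [hu, pow_succ _ j, pow_succ _ (j + 1)]
        generalize (p : ℂ) ^ 2 - ((p : ℂ) ^ 2)⁻¹ = D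
        field_simp
        ring
    -- Since `[0]_q = 0`, the sum of the `A j • f j` may be extended to `j = n`.
    have hlast : A n = 0 := by simp [A, qNum]
    have hfirst : E 0 = up p μ n := by
      simp only [E, K, up, Nat.sub_zero, pow_zero, zero_add, pow_one, one_mul,
        mul_div_cancel_right₀ _ (hF n)]
      ring
    rw [t, ih, Finset.sum_mul, Finset.sum_congr rfl hstep, Finset.sum_add_distrib, add_assoc]
    have e4 : up p μ n • (w p μ n * b (p ^ 2)) = E 0 • f 0 := by simp [hf, hfirst]
    rw [e4, ← Finset.sum_range_succ' (fun j => E j • f j)]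
    have e5 : ∑ j ∈ Finset.range n, A j • f j = ∑ j ∈ Finset.range (n + 1), A j • f j := by
      rw [Finset.sum_range_succ, hlast, zero_smul, add_zero]
    rw [e5, ← Finset.sum_add_distrib]
    refine Finset.sum_congr rfl fun j hj => ?_
    obtain ⟨m, rfl⟩ : ∃ m, n = m + j := ⟨n - j, by have := Finset.mem_range.1 hj; omega⟩
    have hFm := hF m
    have hNj := hN j.succ_pos
    have e6 : m + j + 1 = m + (j + 1) := by omega
    rw [← add_smul, hf]
    simp only [A, E, K, tCoeff, Nat.add_sub_cancel, qFact_succ _ (m + j)]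
    -- The two summands of `[m + (j+1)]_q` match `A j` and `E j`.
    rw [e6, qNum_add h2 m (j + 1)]
    congr 1
    generalize (p : ℂ) ^ 2 - ((p : ℂ) ^ 2)⁻¹ = D
    field_simp

/-- The derivative of `v_n` along the family of characters is `[n]_q X_n`. -/
theorem T_eq (hp : ∀ n : ℕ, 0 < n → ((p : ℂ) ^ 2) ^ n ≠ 1) (n : ℕ) :
    T p μ n = qNum ((p : ℂ) ^ 2) n • X p μ n := by
  rw [T, t_eq_sum hp, map_sum, X, Finset.smul_sum, ← Finset.Ico_add_one_right_eq_Icc,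
    Finset.sum_Ico_eq_sum_range]
  refine Finset.sum_congr rfl fun j hj => ?_
  obtain ⟨n, rfl⟩ : ∃ m, n = m + 1 := ⟨n - 1, by have := Finset.mem_range.1 hj; omega⟩
  rw [v, act_proj, smul_smul, map_smul, tCoeff, qFact_succ]
  have e1 : n + 1 - 1 - j = n + 1 - (1 + j) := by omega
  rw [e1, add_comm 1 j, Nat.add_sub_cancel, Nat.add_sub_cancel]
  congr 1
  ring

theorem X_eq (hp : ∀ n : ℕ, 0 < n → ((p : ℂ) ^ 2) ^ n ≠ 1) {n : ℕ} (hn : 1 ≤ n) :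
    X p μ n = (qNum ((p : ℂ) ^ 2) n)⁻¹ • T p μ n := by
  rw [T_eq hp, smul_smul, inv_mul_cancel₀, one_smul]
  exact qNum_ne_zero hp (pow_ne_zero 2 p.coe_ne_zero) hn

/-! ### The group-like elements are distinct -/

variable (p μ) in
-- As `b` is nilpotent and `c` a multiple of it, `b c = 0`, and `a`, `d` are mutually inverse
-- diagonal matrices. The multiple makes `genY` vanish for `ν = μ²`; the scale of `b` is such that
-- the row `(1, 2)` annihilates `genX`.
theorem spherical_rels : Rels (p ^ 2) !![(1 : ℂ), 0; 0, ((p : ℂ) ^ 2)⁻¹]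
    !![0, ((p : ℂ) ^ 2 - ((p : ℂ) ^ 2)⁻¹) / (p * μ); 0, 0]
    (-((p : ℂ) ^ 2 * μ ^ 2) • !![0, ((p : ℂ) ^ 2 - ((p : ℂ) ^ 2)⁻¹) / (p * μ); 0, 0])
    !![1, 0; 0, (p : ℂ) ^ 2] := by
  have h0 : (p : ℂ) ≠ 0 := p.coe_ne_zero
  constructor <;> ext i j <;> fin_cases i <;> fin_cases j <;>
    simp [Matrix.mul_apply, Fin.sum_univ_two, -Circle.coe_inv] <;> field_simp

variable (p μ) in
/-- The two-dimensional representation of `SL_q(2)` in which the elements of the coideal kill a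
linear functional. -/
def sphericalRep : SLq (p ^ 2) →ₐ[ℂ] Matrix (Fin 2) (Fin 2) ℂ :=
  lift (p ^ 2) _ _ _ _ (spherical_rels p μ)

variable (p μ) in
/-- The linear map `x ↦ (1, 2) ρ(x)`, for `ρ` the spherical representation. -/
def sphericalMap : SLq (p ^ 2) →ₗ[ℂ] Fin 2 → ℂ where
  toFun x := Matrix.vecMul ![1, 2] (sphericalRep p μ x)
  map_add' x y := by rw [map_add, Matrix.vecMul_add]
  map_smul' z x := by rw [map_smul, Matrix.vecMul_smul]; rfl

theorem sphericalMap_mul (x y : SLq (p ^ 2)) :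
    sphericalMap p μ (x * y) = Matrix.vecMul (sphericalMap p μ x) (sphericalRep p μ y) := by
  simp [sphericalMap]

theorem sphericalMap_eq_zero (hμ : μ ≠ 0) {x : SLq (p ^ 2)} (hx : x ∈ rightIdeal p μ (μ ^ 2)) :
    sphericalMap p μ x = 0 := by
  have h0 : (p : ℂ) ≠ 0 := p.coe_ne_zero
  have h1 : (μ : ℂ) ≠ 0 := by exact_mod_cast hμ
  induction hx using Submodule.mul_induction_on' with
  | add x _ y _ hx hy => rw [map_add, hx, hy, add_zero]
  | mem_mul_mem m hm n _ =>
    suffices h : sphericalMap p μ m = 0 by rw [sphericalMap_mul, h, Matrix.zero_vecMul]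
    induction hm using Submodule.span_induction with
    | mem x hx =>
      rcases hx with rfl | rfl <;> ext i <;> fin_cases i <;>
        simp [sphericalMap, sphericalRep, genX, genY, Matrix.vecMul, dotProduct,
          Fin.sum_univ_two] <;> field_simp <;> ring
    | zero => simp
    | add x y _ _ hx hy => rw [map_add, hx, hy, add_zero]
    | smul z x _ hx => rw [map_smul, hx, smul_zero]

theorem sphericalMap_w (hμ : μ ≠ 0) (n : ℕ) :
    sphericalMap p μ (w p μ n) = ![1, ((p : ℂ) ^ 2) ^ n + (((p : ℂ) ^ 2) ^ n)⁻¹] := by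
  have h0 : (p : ℂ) ≠ 0 := p.coe_ne_zero
  have h1 : (μ : ℂ) ≠ 0 := by exact_mod_cast hμ
  induction n with
  | zero =>
    ext i; fin_cases i <;> simp [sphericalMap, w]; norm_num
  | succ n ih =>
    rw [w_succ, sphericalMap_mul, ih]
    ext i; fin_cases i <;> simp [sphericalRep, Matrix.vecMul, dotProduct, Fin.sum_univ_two, up]
    field_simp
    ring

/-- The equation `Q^n + Q^(-n) = Q^m + Q^(-m)` amounts to `(Q^(n-m) - 1) (Q^(n+m) - 1) = 0`. -/
theorem add_inv_injective {Q : ℂ} (hQ : ∀ n : ℕ, 0 < n → Q ^ n ≠ 1) (h0 : Q ≠ 0) :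
    Function.Injective fun n : ℕ => Q ^ n + (Q ^ n)⁻¹ := by
  refine Function.Injective.of_lt_imp_ne fun m n hmn h => ?_
  obtain ⟨k, rfl⟩ := Nat.exists_eq_add_of_lt hmn
  have h1 : (Q ^ (k + 1) - 1) * (Q ^ (m + m + k + 1) - 1) = 0 := by
    have := pow_ne_zero m h0
    have := pow_ne_zero (m + k + 1) h0
    field_simp at h
    refine mul_left_cancel₀ (pow_ne_zero m h0) ?_
    linear_combination -h
  rcases mul_eq_zero.1 h1 with h2 | h2
  · exact hQ _ (by omega) (sub_eq_zero.1 h2)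
  · exact hQ _ (by omega) (sub_eq_zero.1 h2)

theorem v_injective (hp : ∀ n : ℕ, 0 < n → ((p : ℂ) ^ 2) ^ n ≠ 1) (hμ : μ ≠ 0) :
    Function.Injective (v p μ) := by
  intro m n h
  have h1 : w p μ m - w p μ n ∈ rightIdeal p μ (μ ^ 2) := (Submodule.Quotient.eq _).1 h
  have h2 := sphericalMap_eq_zero hμ h1
  rw [map_sub, sphericalMap_w hμ, sphericalMap_w hμ, sub_eq_zero] at h2
  exact add_inv_injective hp (pow_ne_zero 2 p.coe_ne_zero) (congrFun h2 1)

theorem linearIndependent_v (hp : ∀ n : ℕ, 0 < n → ((p : ℂ) ^ 2) ^ n ≠ 1) (hμ : μ ≠ 0) :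
    LinearIndependent ℂ (v p μ) := by
  have h := linearIndepOn_isGroupLikeElem (R := ℂ) (A := Rq p μ)
  exact LinearIndependent.comp h (fun n => ⟨v p μ n, isGroupLikeElem_v p μ n⟩)
    fun m n hmn => v_injective hp hμ (congrArg Subtype.val hmn)

end Rq

end

/-! ### Independence of group-like and skew-primitive elements -/

noncomputable section

open SLq CoisoK

namespace Rq

/-- Linearly independent vectors have a dual family of functionals. -/
theorem exists_dual {R : Type*} [AddCommGroup R] [Module ℂ R] {v : ℕ → R}
    (h : LinearIndependent ℂ v) :
    ∃ f : ℕ → R →ₗ[ℂ] ℂ, ∀ m n, f m (v n) = if n = m then 1 else 0 := by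
  obtain ⟨g, hg⟩ := LinearMap.exists_leftInverse_of_injective
    (Finsupp.linearCombination ℂ v) (LinearMap.ker_eq_bot.2 h)
  refine ⟨fun m => Finsupp.lapply m ∘ₗ g, fun m n => ?_⟩
  have := LinearMap.congr_fun hg (Finsupp.single n 1)
  simp only [LinearMap.comp_apply, Finsupp.linearCombination_single, one_smul,
    LinearMap.id_apply] at this
  simp [this, Finsupp.single_apply]

section Coalgebra

variable {R : Type*} [AddCommGroup R] [Module ℂ R] [Coalgebra ℂ R]

/-- The convolution operator `(f ⊗ id) ∘ Δ` of a linear functional. -/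
def convOp (f : R →ₗ[ℂ] ℂ) : R →ₗ[ℂ] R :=
  (TensorProduct.lid ℂ R).toLinearMap ∘ₗ f.rTensor R ∘ₗ Coalgebra.comul

variable {v : ℕ → R} {f : ℕ → R →ₗ[ℂ] ℂ} (hv : ∀ n, IsGroupLikeElem ℂ (v n))
  (hf : ∀ m n, f m (v n) = if n = m then 1 else 0)

include hv hf in
theorem convOp_of_mem_span {x : R} (hx : x ∈ Submodule.span ℂ (Set.range v)) (m : ℕ) :
    convOp (f m) x = f m x • v m := by
  induction hx using Submodule.span_induction with
  | mem x hx =>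
    obtain ⟨n, rfl⟩ := hx
    simp only [convOp, LinearMap.comp_apply, (hv n).comul_eq_tmul_self, LinearMap.rTensor_tmul,
      hf, LinearEquiv.coe_coe, TensorProduct.lid_tmul]
    split_ifs with h <;> simp [h]
  | zero => simp
  | add x y _ _ hx hy => rw [map_add, map_add, hx, hy, add_smul]
  | smul z x _ hx => rw [map_smul, map_smul, hx, smul_assoc]

include hf in
theorem convOp_of_comul_eq {x : R} {n : ℕ}
    (hx : Coalgebra.comul (R := ℂ) x = x ⊗ₜ v n + v n ⊗ₜ x) (m : ℕ) :
    convOp (f m) x = f m x • v n + if n = m then x else 0 := by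
  simp only [convOp, LinearMap.comp_apply, hx, map_add, LinearMap.rTensor_tmul, hf,
    LinearEquiv.coe_coe, TensorProduct.lid_tmul, ite_smul, one_smul, zero_smul]

include hv in
/-- A skew-primitive element in the span of linearly independent group-like elements vanishes. -/
theorem eq_zero_of_mem_span (h : LinearIndependent ℂ v) {x : R} {n : ℕ}
    (hx : Coalgebra.comul (R := ℂ) x = x ⊗ₜ v n + v n ⊗ₜ x)
    (hxv : x ∈ Submodule.span ℂ (Set.range v)) : x = 0 := by
  obtain ⟨f, hf⟩ := exists_dual h
  -- Convolution with the functional dual to `v n` gives `f n x • v n` by membership in the span,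
  -- but `f n x • v n + x` by skew-primitivity.
  have h1 := convOp_of_mem_span hv hf hxv n
  rw [convOp_of_comul_eq hf hx, if_pos rfl] at h1
  simpa using h1

include hv in
-- Modulo the span `V` of the group-likes, convolution with the functional dual to `v (i + 1)`
-- extracts the term `g i • x i` from a combination of the `x j`, and it maps `V` to itself. A
-- relation modulo `V` with `g i ≠ 0` would thus put `x i` in `V`.
theorem linearIndependent_sumElim (h : LinearIndependent ℂ v) {x : ℕ → R}
    (hx : ∀ n, Coalgebra.comul (R := ℂ) (x n) = x n ⊗ₜ v (n + 1) + v (n + 1) ⊗ₜ x n)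
    (h0 : ∀ n, x n ≠ 0) : LinearIndependent ℂ (Sum.elim v x) := by
  obtain ⟨f, hf⟩ := exists_dual h
  set V := Submodule.span ℂ (Set.range v)
  have hmem : ∀ n, v n ∈ V := fun n => Submodule.subset_span ⟨n, rfl⟩
  refine LinearIndependent.sumElim_of_quotient (M' := V) (f := fun n => ⟨v n, hmem n⟩)
    (LinearIndependent.of_comp V.subtype h) x ?_
  rw [linearIndependent_iff']
  intro s g hg i hi
  by_contra hgi
  have h1 : ∑ j ∈ s, g j • x j ∈ V := by
    rw [← Submodule.Quotient.mk_eq_zero, ← hg, ← Submodule.mkQ_apply, map_sum]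
    simp
  have h2 : convOp (f (i + 1)) (∑ j ∈ s, g j • x j) ∈ V := by
    rw [convOp_of_mem_span hv hf h1]
    exact V.smul_mem _ (hmem _)
  simp only [map_sum, map_smul, convOp_of_comul_eq hf (hx _), smul_add, Finset.sum_add_distrib,
    Nat.add_right_cancel_iff, smul_ite, smul_zero, Finset.sum_ite_eq', hi, if_true] at h2
  rw [V.add_mem_iff_right (V.sum_mem fun j _ => V.smul_mem _ (V.smul_mem _ (hmem _))),
    V.smul_mem_iff hgi] at h2
  exact h0 i (eq_zero_of_mem_span hv h (hx i) h2)

end Coalgebra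

/-! ### Three-term relations and spanning -/

variable {p : Circle} {μ : ℝ}

theorem up_sub_down_ne_zero (hp : ∀ n : ℕ, 0 < n → ((p : ℂ) ^ 2) ^ n ≠ 1) (hμ : μ ≠ 0) (n : ℕ) :
    up p μ (n + 1) - down p μ (n + 1) ≠ 0 := by
  have h0 : (p : ℂ) ≠ 0 := p.coe_ne_zero
  have h1 : (μ : ℂ) ≠ 0 := by exact_mod_cast hμ
  rw [up, down, ← sub_mul]
  exact mul_ne_zero (pow_sub_inv_ne_zero hp (pow_ne_zero 2 h0) n.succ_pos) (mul_ne_zero h0 h1)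

theorem v_succ (n : ℕ) : v p μ (n + 1) =
    act p μ (μ ^ 2) (a _) (v p μ n) + up p μ n • act p μ (μ ^ 2) (b _) (v p μ n) := by
  simp only [v, act_proj, w_succ, mul_add, mul_smul_comm, map_add, map_smul]

theorem T_succ (n : ℕ) : T p μ (n + 1) =
    act p μ (μ ^ 2) (a _) (T p μ n) + up p μ n • act p μ (μ ^ 2) (b _) (T p μ n) +
      up p μ n • act p μ (μ ^ 2) (b _) (v p μ n) := by
  simp only [T, v, act_proj, t, mul_add, mul_smul_comm, map_add, map_smul]

theorem v_pred (n : ℕ) : act p μ (μ ^ 2) (a _) (v p μ (n + 1)) +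
    down p μ (n + 1) • act p μ (μ ^ 2) (b _) (v p μ (n + 1)) = v p μ n := by
  have h := (isTangent_w p μ n).step_back
  simp only [zero_mul, smul_zero, add_zero, map_zero, ← w_succ, ← down_succ] at h
  rw [mul_add, mul_smul_comm, map_add, map_smul] at h
  exact h

theorem T_pred (n : ℕ) : act p μ (μ ^ 2) (a _) (T p μ (n + 1)) +
    down p μ (n + 1) • act p μ (μ ^ 2) (b _) (T p μ (n + 1)) =
      T p μ n + down p μ (n + 1) • act p μ (μ ^ 2) (b _) (v p μ (n + 1)) := by
  have h := (isTangent_t p μ n).step_back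
  simp only [← w_succ, ← down_succ] at h
  rw [← t, mul_add, mul_smul_comm, map_add, map_smul] at h
  exact h

/-- The raising operator `a + β b` and the lowering operator `a + γ b` differ by `(β - γ) b`. -/
theorem act_b_v_succ (n : ℕ) :
    (up p μ (n + 1) - down p μ (n + 1)) • act p μ (μ ^ 2) (b _) (v p μ (n + 1)) =
      v p μ (n + 2) - v p μ n := by
  rw [v_succ (n + 1), ← v_pred n]; module

theorem act_b_T_succ (n : ℕ) :
    (up p μ (n + 1) - down p μ (n + 1)) • act p μ (μ ^ 2) (b _) (T p μ (n + 1)) =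
      T p μ (n + 2) - T p μ n -
        (up p μ (n + 1) + down p μ (n + 1)) • act p μ (μ ^ 2) (b _) (v p μ (n + 1)) := by
  rw [T_succ (n + 1), eq_sub_of_add_eq (T_pred n).symm]; module

theorem up_ne_zero (hμ : μ ≠ 0) (n : ℕ) : up p μ n ≠ 0 := by
  have h1 : (μ : ℂ) ≠ 0 := by exact_mod_cast hμ
  exact mul_ne_zero (pow_ne_zero _ (pow_ne_zero _ p.coe_ne_zero)) (mul_ne_zero p.coe_ne_zero h1)

/-- If `T_(n+1) = 0`, then `T_(n+2)` is a multiple of `v_(n+1) · b`, hence a skew-primitive element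
in the span of the `v_k`, hence zero. Then `v_(n+1) · b = 0`, and the three-term relation forces
`v_(n+2) = v_n`. -/
theorem T_ne_zero (hp : ∀ n : ℕ, 0 < n → ((p : ℂ) ^ 2) ^ n ≠ 1) (hμ : μ ≠ 0) (n : ℕ) :
    T p μ (n + 1) ≠ 0 := by
  intro h
  have h1 := T_succ (p := p) (μ := μ) (n + 1)
  simp only [h, map_zero, smul_zero, add_zero, zero_add] at h1
  have hD := up_sub_down_ne_zero hp hμ n
  have hb : act p μ (μ ^ 2) (b _) (v p μ (n + 1)) ∈ Submodule.span ℂ (Set.range (v p μ)) := by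
    rw [← Submodule.smul_mem_iff _ hD, act_b_v_succ]
    exact sub_mem (Submodule.subset_span ⟨_, rfl⟩) (Submodule.subset_span ⟨_, rfl⟩)
  have h2 : T p μ (n + 1 + 1) = 0 :=
    eq_zero_of_mem_span (isGroupLikeElem_v p μ) (linearIndependent_v hp hμ) (comul_T p μ _)
      (h1 ▸ Submodule.smul_mem _ _ hb)
  rw [h2, eq_comm, smul_eq_zero_iff_right (up_ne_zero hμ _)] at h1
  have h3 := act_b_v_succ (p := p) (μ := μ) n
  rw [h1, smul_zero, eq_comm, sub_eq_zero] at h3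
  have := v_injective hp hμ h3
  omega

theorem act_mem {W : Submodule ℂ (Rq p μ)} (ha : ∀ m ∈ W, act p μ (μ ^ 2) (a _) m ∈ W)
    (hb : ∀ m ∈ W, act p μ (μ ^ 2) (b _) m ∈ W) (hc : ∀ m ∈ W, act p μ (μ ^ 2) (c _) m ∈ W)
    (hd : ∀ m ∈ W, act p μ (μ ^ 2) (d _) m ∈ W) (x : SLq (p ^ 2)) :
    ∀ m ∈ W, act p μ (μ ^ 2) x m ∈ W := by
  induction x using SLq.induction with
  | hz z =>
    intro m hm
    obtain ⟨y, rfl⟩ := Submodule.mkQ_surjective _ m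
    change proj p μ (μ ^ 2) (y * _) ∈ W
    rw [← Algebra.commutes, ← Algebra.smul_def, map_smul]
    exact W.smul_mem _ hm
  | ha => exact ha
  | hb => exact hb
  | hc => exact hc
  | hd => exact hd
  | hadd x y hx hy =>
    intro m hm
    have := W.add_mem (hx m hm) (hy m hm)
    obtain ⟨z, rfl⟩ := Submodule.mkQ_surjective _ m
    change proj p μ (μ ^ 2) (z * _) ∈ W
    rw [mul_add, map_add]
    exact this
  | hmul x y hx hy =>
    intro m hm
    have := hy _ (hx m hm)
    obtain ⟨z, rfl⟩ := Submodule.mkQ_surjective _ m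
    change proj p μ (μ ^ 2) (z * _) ∈ W
    rw [← mul_assoc]
    exact this

/-- The span is a submodule for the right action and contains `v_0 = r[1]`, which generates the
whole quotient. -/
theorem span_range_v_union_range_T (hp : ∀ n : ℕ, 0 < n → ((p : ℂ) ^ 2) ^ n ≠ 1) (hμ : μ ≠ 0) :
    Submodule.span ℂ (Set.range (v p μ) ∪ Set.range (T p μ)) = ⊤ := by
  set W := Submodule.span ℂ (Set.range (v p μ) ∪ Set.range (T p μ))
  have hv : ∀ n, v p μ n ∈ W := fun n => Submodule.subset_span (Or.inl ⟨n, rfl⟩)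
  have hT : ∀ n, T p μ n ∈ W := fun n => Submodule.subset_span (Or.inr ⟨n, rfl⟩)
  have hbv : ∀ n, act p μ (μ ^ 2) (b _) (v p μ n) ∈ W := by
    rintro (_ | n)
    -- At the double weight `β_0 = γ_0` the three-term relation is not available; instead `T_1 = β_0
    -- v_0 · b`. Here the derivatives become indispensable.
    · have h := T_succ (p := p) (μ := μ) 0
      rw [show T p μ 0 = 0 by simp [T, t], map_zero, map_zero, smul_zero, zero_add, zero_add, zero_add] at h
      rw [← W.smul_mem_iff (up_ne_zero (p := p) hμ 0), ← h]
      exact hT _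
    · rw [← W.smul_mem_iff (up_sub_down_ne_zero hp hμ n), act_b_v_succ]
      exact sub_mem (hv _) (hv _)
  have hbT : ∀ n, act p μ (μ ^ 2) (b _) (T p μ n) ∈ W := by
    rintro (_ | n)
    · simp [T, t]
    · rw [← W.smul_mem_iff (up_sub_down_ne_zero hp hμ n), act_b_T_succ]
      exact sub_mem (sub_mem (hT _) (hT _)) (W.smul_mem _ (hbv _))
  have hav : ∀ n, act p μ (μ ^ 2) (a _) (v p μ n) ∈ W := fun n => by
    rw [eq_sub_of_add_eq (v_succ n).symm]
    exact sub_mem (hv _) (W.smul_mem _ (hbv _))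
  have haT : ∀ n, act p μ (μ ^ 2) (a _) (T p μ n) ∈ W := fun n => by
    have h := T_succ (p := p) (μ := μ) n
    rw [add_assoc] at h
    rw [eq_sub_of_add_eq h.symm]
    exact sub_mem (hT _) (add_mem (W.smul_mem _ (hbT _)) (W.smul_mem _ (hbv _)))
  have key : ∀ y : SLq (p ^ 2), (∀ n, act p μ (μ ^ 2) y (v p μ n) ∈ W) →
      (∀ n, act p μ (μ ^ 2) y (T p μ n) ∈ W) → ∀ m ∈ W, act p μ (μ ^ 2) y m ∈ W := by
    intro y h1 h2 m hm
    refine (Submodule.span_le (p := W.comap (act p μ (μ ^ 2) y))).2 ?_ hm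
    rintro _ (⟨n, rfl⟩ | ⟨n, rfl⟩)
    · exact h1 n
    · exact h2 n
  have hcv : ∀ n, act p μ (μ ^ 2) (c _) (v p μ n) ∈ W := fun n => by
    rw [v, act_proj, (isTangent_w p μ n).mul_c]
    exact W.smul_mem _ (hbv n)
  have hcT : ∀ n, act p μ (μ ^ 2) (c _) (T p μ n) ∈ W := fun n => by
    rw [T, act_proj, (isTangent_t p μ n).mul_c]
    exact W.smul_mem _ (hbT n)
  have hdv : ∀ n, act p μ (μ ^ 2) (d _) (v p μ n) ∈ W := fun n => by
    rw [v, act_proj, (isTangent_w p μ n).mul_d]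
    exact add_mem (add_mem (hav n) (W.smul_mem _ (hbv n))) (by simp)
  have hdT : ∀ n, act p μ (μ ^ 2) (d _) (T p μ n) ∈ W := fun n => by
    rw [T, act_proj, (isTangent_t p μ n).mul_d]
    exact add_mem (add_mem (haT n) (W.smul_mem _ (hbT n))) (W.smul_mem _ (hbv n))
  refine eq_top_iff.2 fun m _ => ?_
  obtain ⟨x, rfl⟩ := Submodule.mkQ_surjective _ m
  have h := act_mem (key _ hav haT) (key _ hbv hbT) (key _ hcv hcT) (key _ hdv hdT) x _ (hv 0)
  rw [v, act_proj, w, one_mul] at h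
  exact h

end Rq

end

/-! ### The basis of `R_q` -/

theorem mainTheorem3 (p : Circle) (hp : ∀ n : ℕ, 0 < n → (p ^ 2) ^ n ≠ 1)
    (μ : ℝ) (hμ : μ ≠ 0) :
    (∀ n : ℕ, IsGroupLikeElem ℂ (Rq.v p μ n)) ∧
    (∀ n : ℕ, 1 ≤ n → Coalgebra.comul (R := ℂ) (Rq.X p μ n) =
      Rq.X p μ n ⊗ₜ[ℂ] Rq.v p μ n + Rq.v p μ n ⊗ₜ[ℂ] Rq.X p μ n) ∧
    (∀ n : ℕ, 1 ≤ n → CoisoK.tau p μ (μ ^ 2) (Rq.X p μ n) = -Rq.X p μ n) ∧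
    LinearIndependent ℂ (Sum.elim (fun n : ℕ => Rq.v p μ n) (fun n : ℕ => Rq.X p μ (n + 1))) ∧
    Submodule.span ℂ (Set.range
      (Sum.elim (fun n : ℕ => Rq.v p μ n) (fun n : ℕ => Rq.X p μ (n + 1)))) = ⊤ := by
  have hp' : ∀ n : ℕ, 0 < n → ((p : ℂ) ^ 2) ^ n ≠ 1 := fun n hn h =>
    hp n hn (Circle.ext (by push_cast; exact h))
  have hX : ∀ n : ℕ, 1 ≤ n → Coalgebra.comul (R := ℂ) (Rq.X p μ n) =
      Rq.X p μ n ⊗ₜ[ℂ] Rq.v p μ n + Rq.v p μ n ⊗ₜ[ℂ] Rq.X p μ n := fun n hn => by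
    rw [Rq.X_eq hp' hn, map_smul, Rq.comul_T, smul_add, TensorProduct.smul_tmul',
      TensorProduct.tmul_smul]
  refine ⟨Rq.isGroupLikeElem_v p μ, hX, fun n hn => ?_, ?_, ?_⟩
  -- As `τ` is antilinear, passing from `T_n` to `X_n` needs `[n]_q` to be real.
  · have h := Rq.conj_qNum (p ^ 2) n
    rw [Circle.coe_pow] at h
    rw [Rq.X_eq hp' hn, LinearMap.map_smulₛₗ, Rq.tau_T, map_inv₀, h, smul_neg]
  · refine Rq.linearIndependent_sumElim (Rq.isGroupLikeElem_v p μ)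
      (Rq.linearIndependent_v hp' hμ) (fun n => hX (n + 1) n.succ_pos) fun n h => ?_
    apply Rq.T_ne_zero hp' hμ n
    rw [Rq.T_eq hp', h, smul_zero]
  · rw [← top_le_iff, ← Rq.span_range_v_union_range_T hp' hμ, Submodule.span_le]
    rintro _ (⟨n, rfl⟩ | ⟨n, rfl⟩)
    · exact Submodule.subset_span ⟨.inl n, rfl⟩
    · rcases n with _ | n
      -- `T_0 = 0` has no counterpart among the `X_n` with `n ≥ 1`.
      · simp [Rq.T, Rq.t]
      · rw [Rq.T_eq hp']
        exact Submodule.smul_mem _ _ (Submodule.subset_span ⟨.inr n, rfl⟩)
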